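/- Let $\mathbb{K}\in\{\mathbb{R},\mathbb{C}\}$ and let $\mathcal{F}_d$ be the asymptotic density filter on $\mathbb{N}=\{0,1,2,\ldots\}$, i.e. the filter of all sets $A\subseteq\mathbb{N}$ with $$\lim_{n\to\infty}\frac{|\{k<n : k\in A\}|}{n}=1.$$ Let $X$ be an infinite-dimensional metrizable locally convex topological vector space over $\mathbb{K}$. Then there exists a sequence $(\varphi_l)_{l\in\mathbb{N}}$ of continuous linear functionals $\varphi_l: X\to\mathbb{K}$ such that 1. $(\varphi_l)_l$ converges pointwise statistically to zero: for every $x\in X$ and every $\varepsilon>0$, $\{l\in\mathbb{N} : |\varphi_l(x)|<\varepsilon\}\in\mathcal{F}_d$; and 2. $(\varphi_l)_l$ is not $\mathcal{F}_d$-equicontinuous, where a sequence $(\varphi_l)_l$ is called $\mathcal{F}_d$-equicontinuous if for every $0$-neighbourhood $V$ in $\mathbb{K}$ there exists a $0$-neighbourhood $U$ in $X$ such that $\{l\in\mathbb{N} : \varphi_l[U]\subseteq V\}\in\mathcal{F}_d$. -/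

import Mathlib

open Filter Topology

noncomputable section

/-- The proportion of elements of `{0, …, n - 1}` that lie in `A`. -/
def densityRatio (A : Set ℕ) (n : ℕ) : ℝ :=
  (Set.ncard {k : ℕ | k < n ∧ k ∈ A} : ℝ) / (n : ℝ)

theorem finite_initial (A : Set ℕ) (n : ℕ) : {k : ℕ | k < n ∧ k ∈ A}.Finite :=
  (Set.finite_lt_nat n).subset fun _ hk => hk.1

theorem densityRatio_mono {A B : Set ℕ} (h : A ⊆ B) (n : ℕ) :
    densityRatio A n ≤ densityRatio B n := by
  unfold densityRatio
  have := Set.ncard_le_ncard (s := {k : ℕ | k < n ∧ k ∈ A}) (t := {k : ℕ | k < n ∧ k ∈ B})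
    (fun k hk => ⟨hk.1, h hk.2⟩) (finite_initial B n)
  gcongr

theorem ncard_initial_univ (n : ℕ) : Set.ncard {k : ℕ | k < n ∧ k ∈ (Set.univ : Set ℕ)} = n := by
  have : {k : ℕ | k < n ∧ k ∈ (Set.univ : Set ℕ)} = ((Finset.range n : Finset ℕ) : Set ℕ) := by
    ext k; simp
  rw [this, Set.ncard_coe_finset, Finset.card_range]

theorem densityRatio_univ {n : ℕ} (hn : 0 < n) : densityRatio Set.univ n = 1 := by
  unfold densityRatio
  rw [ncard_initial_univ]
  exact div_self (by positivity)

theorem densityRatio_le_one (A : Set ℕ) {n : ℕ} (hn : 0 < n) : densityRatio A n ≤ 1 :=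
  (densityRatio_mono (Set.subset_univ A) n).trans_eq (densityRatio_univ hn)

theorem densityRatio_inter (A B : Set ℕ) {n : ℕ} (hn : 0 < n) :
    densityRatio A n + densityRatio B n - 1 ≤ densityRatio (A ∩ B) n := by
  have h1 := Set.ncard_union_add_ncard_inter {k : ℕ | k < n ∧ k ∈ A} {k : ℕ | k < n ∧ k ∈ B}
    (finite_initial A n) (finite_initial B n)
  have h2 : {k : ℕ | k < n ∧ k ∈ A} ∩ {k : ℕ | k < n ∧ k ∈ B}
      = {k : ℕ | k < n ∧ k ∈ A ∩ B} := by
    ext k; simp; tauto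
  have h3 : Set.ncard ({k : ℕ | k < n ∧ k ∈ A} ∪ {k : ℕ | k < n ∧ k ∈ B}) ≤ n := by
    conv_rhs => rw [← ncard_initial_univ n]
    refine Set.ncard_le_ncard ?_ (finite_initial _ n)
    rintro k (hk | hk) <;> exact ⟨hk.1, trivial⟩
  rw [h2] at h1
  have h4 : Set.ncard {k : ℕ | k < n ∧ k ∈ A} + Set.ncard {k : ℕ | k < n ∧ k ∈ B}
      ≤ Set.ncard {k : ℕ | k < n ∧ k ∈ A ∩ B} + n := by omega
  have h5 : (Set.ncard {k : ℕ | k < n ∧ k ∈ A} : ℝ) + (Set.ncard {k : ℕ | k < n ∧ k ∈ B} : ℝ)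
      ≤ (Set.ncard {k : ℕ | k < n ∧ k ∈ A ∩ B} : ℝ) + (n : ℝ) := by exact_mod_cast h4
  have hn' : (0 : ℝ) < n := by exact_mod_cast hn
  unfold densityRatio
  rw [← add_div, sub_le_iff_le_add, div_add_one hn'.ne']
  gcongr

/-- The asymptotic density filter on `ℕ`: the sets `A` for which
`|{k < n : k ∈ A}| / n` tends to `1` as `n → ∞`. -/
def asymptoticDensityFilter : Filter ℕ where
  sets := {A : Set ℕ | Tendsto (densityRatio A) atTop (𝓝 1)}
  univ_sets := tendsto_const_nhds.congr' <| by
    filter_upwards [eventually_gt_atTop 0] with n hn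
    exact (densityRatio_univ hn).symm
  sets_of_superset := fun {A B} hA hAB => by
    refine tendsto_of_tendsto_of_tendsto_of_le_of_le' (show Tendsto (densityRatio A) atTop (𝓝 1)
      from hA) tendsto_const_nhds (Eventually.of_forall (densityRatio_mono hAB)) ?_
    filter_upwards [eventually_gt_atTop 0] with n hn
    exact densityRatio_le_one B hn
  inter_sets := fun {A B} hA hB => by
    have h : Tendsto (fun n => densityRatio A n + densityRatio B n - 1) atTop (𝓝 1) := by
      simpa using (Tendsto.add (show Tendsto (densityRatio A) atTop (𝓝 1) from hA)
        (show Tendsto (densityRatio B) atTop (𝓝 1) from hB)).sub_const 1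
    refine tendsto_of_tendsto_of_tendsto_of_le_of_le' h tendsto_const_nhds ?_ ?_
    · filter_upwards [eventually_gt_atTop 0] with n hn
      exact densityRatio_inter A B hn
    · filter_upwards [eventually_gt_atTop 0] with n hn
      exact densityRatio_le_one _ hn

/-- A sequence `T` of continuous linear maps is `F`-equicontinuous if for every `0`-neighbourhood
`V` in `Y` there is a `0`-neighbourhood `U` in `X` with `T i [U] ⊆ V` for `F`-almost all `i`. -/
def FilterEquicontinuous {𝕜 X Y : Type*} [Semiring 𝕜]
    [AddCommMonoid X] [Module 𝕜 X] [TopologicalSpace X]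
    [AddCommMonoid Y] [Module 𝕜 Y] [TopologicalSpace Y]
    (F : Filter ℕ) (T : ℕ → X →L[𝕜] Y) : Prop :=
  ∀ V ∈ 𝓝 (0 : Y), ∃ U ∈ 𝓝 (0 : X), ∀ᶠ i in F, T i '' U ⊆ V

end

/-!
Fix a basis `U 0 ⊇ U 1 ⊇ …` of neighbourhoods of `0` and seminorms `p n` with unit ball in `U n`.
For every seminorm `p` there is a statistically null sequence of functionals none of which is
dominated by `p` (`exists_statistically_null_not_dominated`). With `ψ n` such a sequence for `p n`,
the sequence `φ l = ψ (v l) l`, where `v` is the 2-adic valuation, has the required properties. It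
is statistically null because outside the multiples of `2 ^ n`, which have density `2 ^ (-n)`, only
the finitely many sequences `ψ 0, …, ψ (n - 1)` are involved. It is not equicontinuous along the
density filter because on the nonzero multiples of `2 ^ n`, a set of positive density, no
`φ l` maps `U n` into the open unit ball.

To find the sequence for a given `p`, consider two cases. If some continuous functional `f` is not
dominated by any multiple of `p`, then `f / (l + 1)` works. Otherwise every continuous surjection of
the space onto a Euclidean space is dominated by a multiple of `p`, and the Dvoretzky–Rogers
lemma applies: for every `m` there are functionals `u 0, …, u (m - 1)` with
`∑ i, |u i x| ^ 2 ≤ p x ^ 2` for all `x` and none of them dominated by `p / √2`. Putting `2 u` for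
`m = 2 ^ J` on the block `[2 ^ J, 2 ^ (J + 1))` gives a sequence whose squared absolute values at
`x` sum to `O(log n)` over `{0, …, n - 1}`, so that it is statistically null by Markov's inequality
(`tendsto_asymptoticDensityFilter_of_cesaro`, `tendsto_cesaro_log_block`).

The Dvoretzky–Rogers lemma (`exists_orthonormalBasis_lt_norm_inner`) comes from a map `T` to a
Euclidean space of dimension `2 m` that is dominated by `p` and maximal in the sense that following
it by an endomorphism of determinant greater than `1` in absolute value destroys the domination. If
the projection of `T` to some subspace of dimension more than `m` were dominated by `p / √2`, then
stretching this subspace and shrinking its orthogonal complement would give such an endomorphism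
(`card_le_of_sum_sq_inner_le`); so suitable unit vectors can be chosen one after the other.
-/

/-! ### The asymptotic density filter -/

theorem densityRatio_nonneg (A : Set ℕ) (n : ℕ) : 0 ≤ densityRatio A n := by
  unfold densityRatio
  positivity

theorem densityRatio_compl (A : Set ℕ) {n : ℕ} (hn : 0 < n) :
    densityRatio Aᶜ n = 1 - densityRatio A n := by
  have hdisj : Disjoint {k : ℕ | k < n ∧ k ∈ A} {k : ℕ | k < n ∧ k ∈ Aᶜ} :=
    Set.disjoint_left.2 fun k hk hk' => hk'.2 hk.2
  have hunion : {k : ℕ | k < n ∧ k ∈ A} ∪ {k : ℕ | k < n ∧ k ∈ Aᶜ}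
      = {k : ℕ | k < n ∧ k ∈ (Set.univ : Set ℕ)} := by
    ext k; simp only [Set.mem_union, Set.mem_ofPred_eq, Set.mem_compl_iff, Set.mem_univ]; tauto
  have h := Set.ncard_union_eq hdisj (finite_initial A n) (finite_initial Aᶜ n)
  rw [hunion, ncard_initial_univ] at h
  have hn' : (0 : ℝ) < n := by exact_mod_cast hn
  have h' : (n : ℝ) = Set.ncard {k : ℕ | k < n ∧ k ∈ A} + Set.ncard {k : ℕ | k < n ∧ k ∈ Aᶜ} := by
    exact_mod_cast h
  unfold densityRatio
  rw [eq_sub_iff_add_eq, ← add_div, add_comm, ← h', div_self hn'.ne']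

theorem mem_asymptoticDensityFilter {A : Set ℕ} :
    A ∈ asymptoticDensityFilter ↔ Tendsto (densityRatio A) atTop (𝓝 1) :=
  Iff.rfl

theorem mem_asymptoticDensityFilter_iff_compl {A : Set ℕ} :
    A ∈ asymptoticDensityFilter ↔ Tendsto (densityRatio Aᶜ) atTop (𝓝 0) := by
  rw [mem_asymptoticDensityFilter]
  constructor <;> intro h
  · have h' := (tendsto_const_nhds (x := (1 : ℝ))).sub h
    rw [sub_self] at h'
    refine h'.congr' ?_
    filter_upwards [eventually_gt_atTop 0] with n hn
    exact (densityRatio_compl A hn).symm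
  · have h' := (tendsto_const_nhds (x := (1 : ℝ))).sub h
    rw [sub_zero] at h'
    refine h'.congr' ?_
    filter_upwards [eventually_gt_atTop 0] with n hn
    rw [densityRatio_compl A hn, sub_sub_cancel]

/-- Markov's inequality for the uniform distribution on `{0, …, n - 1}`. -/
theorem densityRatio_le_of_le {f : ℕ → ℝ} (hf : ∀ l, 0 ≤ f l) {ε : ℝ} (hε : 0 < ε) (n : ℕ) :
    densityRatio {l | ε ≤ f l} n ≤ ((n : ℝ)⁻¹ * ∑ l ∈ Finset.range n, f l) / ε := by
  classical
  have hset : {k : ℕ | k < n ∧ k ∈ {l | ε ≤ f l}}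
      = ((Finset.range n).filter (fun l => ε ≤ f l) : Finset ℕ) := by
    ext k; simp
  have hsum : ((Finset.range n).filter (fun l => ε ≤ f l)).card * ε
      ≤ ∑ l ∈ Finset.range n, f l := by
    rw [← nsmul_eq_mul]
    refine (Finset.card_nsmul_le_sum _ f ε fun l hl => (Finset.mem_filter.1 hl).2).trans ?_
    exact Finset.sum_le_sum_of_subset_of_nonneg (Finset.filter_subset _ _) fun l _ _ => hf l
  unfold densityRatio
  rw [hset, Set.ncard_coe_finset, le_div_iff₀ hε, div_eq_inv_mul, mul_assoc]
  gcongr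

/-- Strong Cesàro convergence implies statistical convergence. -/
theorem tendsto_asymptoticDensityFilter_of_cesaro {f : ℕ → ℝ} (hf : ∀ l, 0 ≤ f l)
    (h : Tendsto (fun n : ℕ => (n : ℝ)⁻¹ * ∑ l ∈ Finset.range n, f l) atTop (𝓝 0)) :
    Tendsto f asymptoticDensityFilter (𝓝 0) := by
  refine (nhds_basis_zero_abs_lt ℝ).tendsto_right_iff.2 fun ε hε => ?_
  change {l | |f l| < ε} ∈ asymptoticDensityFilter
  have hcompl : {l | |f l| < ε}ᶜ = {l | ε ≤ f l} := by
    ext l; simp [abs_of_nonneg (hf l)]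
  rw [mem_asymptoticDensityFilter_iff_compl, hcompl]
  refine squeeze_zero (densityRatio_nonneg _) (densityRatio_le_of_le hf hε) ?_
  simpa using h.div_const ε

theorem asymptoticDensityFilter_le_atTop : asymptoticDensityFilter ≤ atTop := by
  have h := tendsto_asymptoticDensityFilter_of_cesaro
    (fun l => by positivity : ∀ l : ℕ, (0 : ℝ) ≤ 1 / ((l : ℝ) + 1))
    tendsto_one_div_add_atTop_nhds_zero_nat.cesaro
  refine tendsto_id'.1 (tendsto_atTop.2 fun N => ?_)
  filter_upwards [h.eventually_lt_const (show (0 : ℝ) < 1 / ((N : ℝ) + 1) by positivity)] with l hl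
  have hlt : (N : ℝ) < l := by
    have := (one_div_lt_one_div (by positivity) (by positivity)).1 hl
    linarith
  exact (Nat.cast_lt.1 hlt).le

theorem tendsto_densityRatio_dvd {r : ℕ} (hr : 0 < r) :
    Tendsto (densityRatio {l | r ∣ l}) atTop (𝓝 (r : ℝ)⁻¹) := by
  classical
  have hcount : ∀ n, Set.ncard {k : ℕ | k < n ∧ k ∈ {l | r ∣ l}}
      = n / r + if 0 < n % r then 1 else 0 := by
    intro n
    have hset : {k : ℕ | k < n ∧ k ∈ {l | r ∣ l}}
        = ((Finset.range n).filter (· ≡ 0 [MOD r]) : Finset ℕ) := by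
      ext k; simp [Nat.modEq_zero_iff_dvd]
    rw [hset, Set.ncard_coe_finset, ← Nat.count_eq_card_filter_range, Nat.count_modEq_card n hr,
      Nat.zero_mod]
  have hr' : (0 : ℝ) < r := by exact_mod_cast hr
  have hinv : Tendsto (fun n : ℕ => (n : ℝ)⁻¹) atTop (𝓝 0) := tendsto_inv_atTop_nhds_zero_nat
  have hlo := (tendsto_const_nhds (x := (r : ℝ)⁻¹)).sub hinv
  have hhi := (tendsto_const_nhds (x := (r : ℝ)⁻¹)).add hinv
  rw [sub_zero] at hlo
  rw [add_zero] at hhi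
  have hbound : ∀ n : ℕ, 0 < n → (r : ℝ)⁻¹ - (n : ℝ)⁻¹ ≤ densityRatio {l | r ∣ l} n ∧
      densityRatio {l | r ∣ l} n ≤ (r : ℝ)⁻¹ + (n : ℝ)⁻¹ := by
    intro n hn
    have hn' : (0 : ℝ) < n := by exact_mod_cast hn
    have h1 : (n / r + if 0 < n % r then 1 else 0) * r ≤ n + r := by
      have := Nat.div_mul_le_self n r
      split_ifs <;> nlinarith
    have h2 : n ≤ (n / r + if 0 < n % r then 1 else 0) * r := by
      have h3 := Nat.div_add_mod' n r
      have h4 := Nat.mod_lt n hr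
      split_ifs with h <;> nlinarith
    rw [← hcount n] at h1 h2
    have h1' : (Set.ncard {k : ℕ | k < n ∧ k ∈ {l | r ∣ l}} : ℝ) * r ≤ n + r := by
      exact_mod_cast h1
    have h2' : (n : ℝ) ≤ (Set.ncard {k : ℕ | k < n ∧ k ∈ {l | r ∣ l}} : ℝ) * r := by
      exact_mod_cast h2
    unfold densityRatio
    have h3 : (r : ℝ)⁻¹ - (n : ℝ)⁻¹ ≤ (r : ℝ)⁻¹ := by simp
    constructor
    · refine h3.trans ?_
      rw [inv_eq_one_div, div_le_div_iff₀ hr' hn']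
      linarith
    · rw [← one_div, ← one_div, div_add_div _ _ hr'.ne' hn'.ne',
        div_le_div_iff₀ hn' (by positivity)]
      nlinarith
  refine tendsto_of_tendsto_of_tendsto_of_le_of_le' hlo hhi ?_ ?_ <;>
    filter_upwards [eventually_gt_atTop 0] with n hn
  exacts [(hbound n hn).1, (hbound n hn).2]

theorem compl_dvd_notMem_asymptoticDensityFilter {r : ℕ} (hr : 0 < r) :
    {l : ℕ | r ∣ l}ᶜ ∉ asymptoticDensityFilter := by
  rw [mem_asymptoticDensityFilter_iff_compl, compl_compl]
  intro h
  have hr' : (0 : ℝ) < r := by exact_mod_cast hr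
  exact (inv_pos.2 hr').ne' (tendsto_nhds_unique (tendsto_densityRatio_dvd hr) h)

/-- A set has density one as soon as it does so up to the multiples of `2 ^ n`, for every `n`:
these multiples have density `2 ^ (-n)`. -/
theorem mem_asymptoticDensityFilter_of_union_dvd {A : Set ℕ}
    (h : ∀ n : ℕ, A ∪ {l | 2 ^ n ∣ l} ∈ asymptoticDensityFilter) :
    A ∈ asymptoticDensityFilter := by
  rw [mem_asymptoticDensityFilter_iff_compl]
  refine tendsto_order.2 ⟨fun a ha => Eventually.of_forall fun n =>
    ha.trans_le (densityRatio_nonneg _ n), fun a ha => ?_⟩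
  obtain ⟨n, hn⟩ := exists_pow_lt_of_lt_one ha (by norm_num : (2 : ℝ)⁻¹ < 1)
  have h1 := (mem_asymptoticDensityFilter.1 (h n)).sub
    (tendsto_densityRatio_dvd (r := 2 ^ n) (by positivity))
  have h2 : 1 - a < 1 - ((2 ^ n : ℕ) : ℝ)⁻¹ := by
    push_cast
    rw [← inv_pow]
    linarith
  filter_upwards [h1.eventually_const_lt h2, eventually_gt_atTop 0] with N hN hN0
  -- The complement of `A` is covered by that of the union and by the multiples of `2 ^ n`.
  have h3 := densityRatio_inter Aᶜ {l | 2 ^ n ∣ l}ᶜ hN0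
  rw [← Set.compl_union, densityRatio_compl _ hN0, densityRatio_compl _ hN0,
    densityRatio_compl _ hN0] at h3
  rw [densityRatio_compl _ hN0]
  linarith

/-! ### Cesàro means of dyadic blocks -/

section Blocks

/-- The index `l` belongs to the block number `J = Nat.log 2 l` and has position `l - 2 ^ J` there;
`l = 0` repeats the single entry of block `0`. -/
theorem sum_range_two_pow_log_block_le {f : ℕ → ℕ → ℝ} {C : ℝ}
    (hC : ∀ J, ∑ i ∈ Finset.range (2 ^ J), f J i ≤ C) (J : ℕ) :
    ∑ l ∈ Finset.range (2 ^ J), f (Nat.log 2 l) (l - 2 ^ Nat.log 2 l) ≤ (J + 1) * C := by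
  induction J with
  | zero => simpa using hC 0
  | succ J ih =>
    have hblock : ∑ i ∈ Finset.range (2 ^ J),
        f (Nat.log 2 (2 ^ J + i)) (2 ^ J + i - 2 ^ Nat.log 2 (2 ^ J + i)) ≤ C := by
      refine le_of_eq_of_le (Finset.sum_congr rfl fun i hi => ?_) (hC J)
      have hlog : Nat.log 2 (2 ^ J + i) = J :=
        Nat.log_eq_of_pow_le_of_lt_pow (by omega)
          (by rw [pow_succ]; have := Finset.mem_range.1 hi; omega)
      rw [hlog, Nat.add_sub_cancel_left]
    rw [pow_succ, mul_two, Finset.sum_range_add]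
    push_cast
    linarith

/-- If `[2 ^ J, 2 ^ (J + 1))` carries the `J`-th of a family of blocks with uniformly bounded sums,
then the sum over `{0, …, n - 1}` is `O(log n)`, hence the Cesàro means tend to zero. -/
theorem tendsto_cesaro_log_block {f : ℕ → ℕ → ℝ} (hf : ∀ J i, 0 ≤ f J i) {C : ℝ}
    (hC : ∀ J, ∑ i ∈ Finset.range (2 ^ J), f J i ≤ C) :
    Tendsto (fun n : ℕ => (n : ℝ)⁻¹ *
      ∑ l ∈ Finset.range n, f (Nat.log 2 l) (l - 2 ^ Nat.log 2 l)) atTop (𝓝 0) := by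
  have hlog : Tendsto (Nat.log 2) atTop atTop :=
    tendsto_atTop_atTop_of_monotone Nat.log_monotone fun J =>
      ⟨2 ^ J, (Nat.log_pow one_lt_two J).ge⟩
  have hlim : Tendsto (fun J : ℕ => ((J : ℝ) + 2) * C / 2 ^ J) atTop (𝓝 0) := by
    have h1 := tendsto_pow_const_div_const_pow_of_one_lt 1 (one_lt_two : (1 : ℝ) < 2)
    have h0 := tendsto_pow_const_div_const_pow_of_one_lt 0 (one_lt_two : (1 : ℝ) < 2)
    have h2 := (h1.add (h0.const_mul 2)).mul_const C
    simp only [mul_zero, add_zero, zero_mul] at h2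
    refine h2.congr fun J => ?_
    ring
  refine squeeze_zero' (Eventually.of_forall fun n => ?_) ?_ (hlim.comp hlog)
  · exact mul_nonneg (by positivity) (Finset.sum_nonneg fun l _ => hf _ _)
  · filter_upwards [eventually_gt_atTop 0] with n hn
    have hC0 : 0 ≤ C := (Finset.sum_nonneg fun i _ => hf 0 i).trans (hC 0)
    have hpow : ((2 : ℝ) ^ Nat.log 2 n) ≤ n := by exact_mod_cast Nat.pow_log_le_self 2 hn.ne'
    have hsum : ∑ l ∈ Finset.range n, f (Nat.log 2 l) (l - 2 ^ Nat.log 2 l)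
        ≤ ((Nat.log 2 n : ℝ) + 2) * C := by
      refine (Finset.sum_le_sum_of_subset_of_nonneg (Finset.range_mono
        (Nat.lt_pow_succ_log_self one_lt_two n).le) fun l _ _ => hf _ _).trans ?_
      refine (sum_range_two_pow_log_block_le hC _).trans_eq ?_
      push_cast
      ring
    rw [Function.comp_apply, ← div_eq_inv_mul]
    exact div_le_div₀ (by positivity) hsum (by positivity) hpow

end Blocks

/-! ### Ellipsoids of maximal volume -/

section Ellipsoid

variable {𝕜 : Type*} [RCLike 𝕜] {X : Type*} [AddCommGroup X] [Module 𝕜 X] [TopologicalSpace X]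
  {H : Type*} [NormedAddCommGroup H] [InnerProductSpace 𝕜 H]

/-- Existence of a maximal ellipsoid: among all maps `S ∘ T₀` dominated by `p`, where `S` is an
endomorphism of `H`, choose one with `|det S|` maximal. -/
theorem exists_dominated_norm_det_le_one [FiniteDimensional 𝕜 H] (p : Seminorm 𝕜 X)
    (T₀ : X →L[𝕜] H)
    (hT₀ : Function.Surjective T₀) {C : ℝ} (hC : ∀ x, ‖T₀ x‖ ≤ C * p x) :
    ∃ T : X →L[𝕜] H, (∀ x, ‖T x‖ ≤ p x) ∧
      ∀ D : H →ₗ[𝕜] H, (∀ x, ‖D (T x)‖ ≤ p x) → ‖LinearMap.det D‖ ≤ 1 := by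
  have : ProperSpace (H →L[𝕜] H) := FiniteDimensional.proper_rclike 𝕜 _
  set K : Set (H →L[𝕜] H) := {S | ∀ x, ‖S (T₀ x)‖ ≤ p x} with hK
  have hclosed : IsClosed K := by
    have : K = ⋂ x, {S : H →L[𝕜] H | ‖S (T₀ x)‖ ≤ p x} := by
      ext S; simp [hK]
    rw [this]
    exact isClosed_iInter fun x => isClosed_le
      ((ContinuousLinearMap.apply 𝕜 H (T₀ x)).continuous.norm) continuous_const
  have hbdd : Bornology.IsBounded K := by
    let b := stdOrthonormalBasis 𝕜 H
    -- A map in `K` is bounded at each basis vector, by the value of `p` at a preimage under `T₀`.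
    choose x hx using fun i => hT₀ (b i)
    refine (isBounded_iff_forall_norm_le).2 ⟨∑ i, p (x i), fun S hS => ?_⟩
    refine S.opNorm_le_bound (Finset.sum_nonneg fun i _ => apply_nonneg p _) fun y => ?_
    rw [Finset.sum_mul]
    conv_lhs => rw [← b.sum_repr' y, map_sum]
    refine (norm_sum_le _ _).trans (Finset.sum_le_sum fun i _ => ?_)
    rw [map_smul, norm_smul, mul_comm, ← hx i]
    refine mul_le_mul (hS _) ?_ (norm_nonneg _) (apply_nonneg p _)
    rw [hx i]
    simpa using norm_inner_le_norm (𝕜 := 𝕜) (b i) y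
  have hcompact : IsCompact K := Metric.isCompact_of_isClosed_isBounded hclosed hbdd
  have hc : 0 < |C| + 1 := by positivity
  set S₀ : H →L[𝕜] H := (((|C| + 1)⁻¹ : ℝ) : 𝕜) • ContinuousLinearMap.id 𝕜 H with hS₀
  have hS₀K : S₀ ∈ K := by
    intro x
    have h1 : ‖T₀ x‖ ≤ (|C| + 1) * p x :=
      (hC x).trans (mul_le_mul_of_nonneg_right (by linarith [le_abs_self C]) (apply_nonneg p x))
    rw [hS₀, smul_apply, norm_smul, RCLike.norm_ofReal,
      abs_of_pos (inv_pos.2 hc), ContinuousLinearMap.id_apply, inv_mul_le_iff₀ hc]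
    exact h1
  have hS₀det : LinearMap.det (S₀ : H →ₗ[𝕜] H) ≠ 0 := by
    have : (S₀ : H →ₗ[𝕜] H) = (((|C| + 1)⁻¹ : ℝ) : 𝕜) • LinearMap.id := rfl
    rw [this, LinearMap.det_smul, LinearMap.det_id, mul_one]
    exact pow_ne_zero _ (RCLike.ofReal_ne_zero.2 (inv_pos.2 hc).ne')
  obtain ⟨S, hSK, hSmax⟩ := hcompact.exists_isMaxOn ⟨S₀, hS₀K⟩
    (ContinuousLinearMap.continuous_det (𝕜 := 𝕜) (E := H)).norm.continuousOn
  refine ⟨S.comp T₀, hSK, fun D hD => ?_⟩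
  have hpos : 0 < ‖S.det‖ := (norm_pos_iff.2 hS₀det).trans_le (hSmax hS₀K)
  have hmem : (LinearMap.toContinuousLinearMap D).comp S ∈ K := fun x => hD x
  have hle : ‖((LinearMap.toContinuousLinearMap D).comp S).det‖ ≤ ‖S.det‖ := hSmax hmem
  have hmul : ((LinearMap.toContinuousLinearMap D).comp S).det = LinearMap.det D * S.det :=
    LinearMap.det_comp D (S : H →ₗ[𝕜] H)
  rw [hmul, norm_mul] at hle
  exact le_of_mul_le_mul_right (by rwa [one_mul]) hpos

/-- The endomorphism that is diagonal with real entries `d` in a given orthonormal basis. -/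
theorem exists_diagonal_endomorphism {ι : Type*} [Fintype ι] (b : OrthonormalBasis ι 𝕜 H)
    (d : ι → ℝ) : ∃ D : H →ₗ[𝕜] H, LinearMap.det D = ((∏ i, d i : ℝ) : 𝕜) ∧
      ∀ y, ‖D y‖ ^ 2 = ∑ i, d i ^ 2 * ‖inner 𝕜 (b i) y‖ ^ 2 := by
  classical
  refine ⟨Matrix.toLin b.toBasis b.toBasis (Matrix.diagonal fun i => (d i : 𝕜)), ?_, fun y => ?_⟩
  · rw [LinearMap.det_toLin, Matrix.det_diagonal]
    push_cast
    rfl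
  · rw [← b.sum_sq_norm_inner_right]
    refine Finset.sum_congr rfl fun i _ => ?_
    rw [← mul_pow, ← sq_abs (d i * _), ← Real.norm_eq_abs, norm_mul, norm_norm,
      Real.norm_eq_abs, ← RCLike.norm_ofReal (K := 𝕜), ← norm_mul]
    congr 2
    rw [← b.repr_apply_apply, ← b.repr_apply_apply, ← b.coe_toBasis_repr_apply,
      ← b.coe_toBasis_repr_apply, ← LinearMap.toMatrix_mulVec_repr b.toBasis b.toBasis,
      LinearMap.toMatrix_toLin, Matrix.mulVec_diagonal]

/-- If `(1 + τ) ^ j * (1 - τ) ^ r ≤ 1` for all small `τ > 0`, then `j ≤ r`. -/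
theorem le_of_one_add_pow_mul_one_sub_pow_le_one {j r : ℕ}
    (h : ∀ τ : ℝ, 0 < τ → τ < 1 → (1 + τ) ^ j * (1 - τ) ^ r ≤ 1) : j ≤ r := by
  by_contra! hjr
  -- For this `τ` already `(1 + τ) * (1 - r * τ ^ 2) > 1`, a lower bound by Bernoulli's inequality.
  set τ : ℝ := 1 / (2 * r + 2) with hτ
  have hr : (0 : ℝ) ≤ r := Nat.cast_nonneg r
  have hτ0 : 0 < τ := by positivity
  have hτr : τ * (2 * r + 2) = 1 := by rw [hτ]; field_simp
  have hτ1 : τ < 1 := by nlinarith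
  have h1 := h τ hτ0 hτ1
  have h2 : (1 + τ) ^ (r + 1) * (1 - τ) ^ r ≤ (1 + τ) ^ j * (1 - τ) ^ r :=
    mul_le_mul_of_nonneg_right (pow_le_pow_right₀ (by linarith) hjr)
      (pow_nonneg (by linarith) _)
  have h3 : (1 + τ) ^ (r + 1) * (1 - τ) ^ r = (1 + τ) * (1 + -τ ^ 2) ^ r := by
    rw [pow_succ, mul_comm _ (1 + τ), mul_assoc, ← mul_pow]
    congr 2
    ring
  have h4 : 1 + (r : ℝ) * -τ ^ 2 ≤ (1 + -τ ^ 2) ^ r := one_add_mul_le_pow (by nlinarith) r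
  have h5 : (1 + τ) * (1 + (r : ℝ) * -τ ^ 2) ≤ 1 := by
    refine (mul_le_mul_of_nonneg_left h4 (by linarith)).trans ?_
    linarith
  have h6 : (r : ℝ) * τ < 1 / 2 := by nlinarith
  have h7 : (r : ℝ) * τ ^ 2 ≤ r * τ := by nlinarith [mul_nonneg hr hτ0.le]
  nlinarith

/-- If a set of coordinates of a maximal ellipsoid carries at most half of the square of `p`, then
it is at most half of all coordinates: otherwise stretching these coordinates and shrinking
the others would increase the determinant. -/
theorem card_le_of_sum_sq_inner_le {p : Seminorm 𝕜 X} {T : X →L[𝕜] H} (hT : ∀ x, ‖T x‖ ≤ p x)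
    (hdet : ∀ D : H →ₗ[𝕜] H, (∀ x, ‖D (T x)‖ ≤ p x) → ‖LinearMap.det D‖ ≤ 1)
    {ι : Type*} [Fintype ι] [DecidableEq ι] (b : OrthonormalBasis ι 𝕜 H) (s : Finset ι)
    (hs : ∀ x, 2 * ∑ i ∈ s, ‖inner 𝕜 (b i) (T x)‖ ^ 2 ≤ p x ^ 2) : s.card ≤ sᶜ.card := by
  refine le_of_one_add_pow_mul_one_sub_pow_le_one fun τ hτ0 hτ1 => ?_
  -- These factors preserve the domination: `(1 - τ) * p ^ 2 + 2 * τ * (p ^ 2 / 2) = p ^ 2`.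
  set d : ι → ℝ := fun i => if i ∈ s then √(1 + τ) else √(1 - τ) with hd
  have hd2 : ∀ i, d i ^ 2 = if i ∈ s then 1 + τ else 1 - τ := by
    intro i
    simp only [hd]
    split_ifs
    exacts [Real.sq_sqrt (by linarith), Real.sq_sqrt (by linarith)]
  obtain ⟨D, hDdet, hD⟩ := exists_diagonal_endomorphism b d
  have hle : ‖LinearMap.det D‖ ≤ 1 := by
    refine hdet D fun x => ?_
    refine le_of_sq_le_sq ?_ (apply_nonneg p x)
    have h1 : ‖D (T x)‖ ^ 2
        = (1 - τ) * ‖T x‖ ^ 2 + τ * (2 * ∑ i ∈ s, ‖inner 𝕜 (b i) (T x)‖ ^ 2) := by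
      have hsplit : ∀ i, d i ^ 2 * ‖inner 𝕜 (b i) (T x)‖ ^ 2
          = (1 - τ) * ‖inner 𝕜 (b i) (T x)‖ ^ 2
            + if i ∈ s then τ * (2 * ‖inner 𝕜 (b i) (T x)‖ ^ 2) else 0 := by
        intro i
        rw [hd2]
        split_ifs <;> ring
      rw [hD, ← b.sum_sq_norm_inner_right (T x), Finset.sum_congr rfl fun i _ => hsplit i,
        Finset.sum_add_distrib, Finset.sum_ite_mem, Finset.univ_inter, ← Finset.mul_sum,
        ← Finset.mul_sum, ← Finset.mul_sum]
    have h2 : ‖T x‖ ^ 2 ≤ p x ^ 2 := pow_le_pow_left₀ (norm_nonneg _) (hT x) 2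
    rw [h1]
    nlinarith [hs x]
  have hprod : (∏ i, d i) ^ 2 = (1 + τ) ^ s.card * (1 - τ) ^ sᶜ.card := by
    rw [← Finset.prod_pow, Finset.prod_congr rfl fun i _ => hd2 i, Finset.prod_ite]
    simp [Finset.filter_not, Finset.compl_eq_univ_sdiff]
  rw [hDdet, RCLike.norm_ofReal] at hle
  rw [← hprod, ← sq_abs]
  exact pow_le_one₀ (abs_nonneg _) hle

end Ellipsoid

/-! ### The Dvoretzky–Rogers lemma -/

section DvoretzkyRogers

variable {𝕜 : Type*} [RCLike 𝕜] {X : Type*} [AddCommGroup X] [Module 𝕜 X] [TopologicalSpace X]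
  {H : Type*} [NormedAddCommGroup H] [InnerProductSpace 𝕜 H] [FiniteDimensional 𝕜 H]

/-- The Dvoretzky–Rogers lemma: half of the coordinate functionals of a maximal ellipsoid, in a
suitable orthonormal basis, are not dominated by `p / √2`. The basis
vectors are found one after the other, `r` being the number of those found. -/
theorem exists_orthonormalBasis_lt_norm_inner {p : Seminorm 𝕜 X} {T : X →L[𝕜] H}
    (hT : ∀ x, ‖T x‖ ≤ p x)
    (hdet : ∀ D : H →ₗ[𝕜] H, (∀ x, ‖D (T x)‖ ≤ p x) → ‖LinearMap.det D‖ ≤ 1)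
    {m : ℕ} (hm : Module.finrank 𝕜 H = 2 * m) {r : ℕ} (hr : r ≤ m) :
    ∃ b : OrthonormalBasis (Fin (2 * m)) 𝕜 H,
      ∀ i : Fin (2 * m), i.1 < r → ∃ x, p x ^ 2 < 2 * ‖inner 𝕜 (b i) (T x)‖ ^ 2 := by
  induction r with
  | zero => exact ⟨(stdOrthonormalBasis 𝕜 H).reindex (finCongr hm), fun i hi => by omega⟩
  | succ r ih =>
    obtain ⟨b, hb⟩ := ih (by omega)
    set s : Finset (Fin (2 * m)) := Finset.univ.filter fun i => r ≤ i.1 with hs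
    have hcard : sᶜ.card < s.card := by
      have h1 : sᶜ.card ≤ r := by
        have h2 : (sᶜ.map Fin.valEmbedding) ⊆ Finset.range r := by
          intro i hi
          simp only [hs, Finset.mem_map, Finset.mem_compl, Finset.mem_filter, Finset.mem_univ,
            true_and, not_le, Fin.valEmbedding_apply] at hi
          obtain ⟨j, hj, rfl⟩ := hi
          exact Finset.mem_range.2 hj
        simpa using Finset.card_le_card h2
      have h3 := s.card_add_card_compl
      rw [Fintype.card_fin] at h3
      omega
    obtain ⟨x, hx⟩ : ∃ x, p x ^ 2 < 2 * ∑ i ∈ s, ‖inner 𝕜 (b i) (T x)‖ ^ 2 := by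
      by_contra! h
      exact absurd (card_le_of_sum_sq_inner_le hT hdet b s h) (not_le.2 hcard)
    -- The direction of the projection of `T x` to the span of the remaining basis vectors
    -- replaces the basis vector with index `r`.
    set w : H := ∑ i ∈ s, inner 𝕜 (b i) (T x) • b i with hw
    have hwT : inner 𝕜 w (T x) = ((∑ i ∈ s, ‖inner 𝕜 (b i) (T x)‖ ^ 2 : ℝ) : 𝕜) := by
      rw [hw, sum_inner]
      push_cast
      refine Finset.sum_congr rfl fun i _ => ?_
      rw [inner_smul_left, RCLike.conj_mul]
    have hwnorm : ‖w‖ ^ 2 = ∑ i ∈ s, ‖inner 𝕜 (b i) (T x)‖ ^ 2 := by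
      have h1 := b.orthonormal.inner_sum (fun i => inner 𝕜 (b i) (T x))
        (fun i => inner 𝕜 (b i) (T x)) s
      rw [← hw, inner_self_eq_norm_sq_to_K] at h1
      have h2 : ((‖w‖ ^ 2 : ℝ) : 𝕜) = ((∑ i ∈ s, ‖inner 𝕜 (b i) (T x)‖ ^ 2 : ℝ) : 𝕜) := by
        push_cast
        rw [h1]
        exact Finset.sum_congr rfl fun i _ => RCLike.conj_mul _
      exact_mod_cast h2
    have hwpos : 0 < ‖w‖ := by
      rw [← hwnorm] at hx
      refine norm_pos_iff.2 fun h0 => ?_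
      rw [h0, norm_zero] at hx
      linarith [sq_nonneg (p x)]
    set v : H := (((‖w‖)⁻¹ : ℝ) : 𝕜) • w with hv
    have hvnorm : ‖v‖ = 1 := by
      rw [hv, norm_smul, RCLike.norm_ofReal, abs_of_pos (inv_pos.2 hwpos),
        inv_mul_cancel₀ hwpos.ne']
    have hvT : ‖inner 𝕜 v (T x)‖ ^ 2 = ‖w‖ ^ 2 := by
      rw [hv, inner_smul_left, hwT, ← hwnorm, norm_mul, RCLike.norm_conj, RCLike.norm_ofReal,
        RCLike.norm_ofReal, abs_of_pos (inv_pos.2 hwpos), abs_of_pos (by positivity)]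
      field_simp
    have hbv : ∀ i : Fin (2 * m), i.1 < r → inner 𝕜 (b i) v = 0 := by
      intro i hi
      have hbw : inner 𝕜 (b i) w = 0 := by
        rw [hw, inner_sum]
        refine Finset.sum_eq_zero fun j hj => ?_
        have hij : i ≠ j := by
          rintro rfl
          exact absurd (Finset.mem_filter.1 hj).2 (not_le.2 hi)
        rw [inner_smul_right, b.orthonormal.inner_eq_zero hij, mul_zero]
      rw [hv, inner_smul_right, hbw, mul_zero]
    let i₀ : Fin (2 * m) := ⟨r, by omega⟩
    have horth : Orthonormal 𝕜 (Set.domRestrict {i : Fin (2 * m) | i.1 ≤ r}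
        (Function.update b i₀ v)) := by
      constructor
      · rintro ⟨i, hi⟩
        by_cases hii : i = i₀
        · subst hii; simpa using hvnorm
        · simp [Function.update_of_ne hii]
      · rintro ⟨i, hi⟩ ⟨j, hj⟩ hij
        have hij' : i ≠ j := fun h => hij (Subtype.ext h)
        have hlt : ∀ k : Fin (2 * m), k.1 ≤ r → k ≠ i₀ → k.1 < r := fun k hk hne =>
          lt_of_le_of_ne hk fun h => hne (Fin.ext h)
        by_cases hii : i = i₀
        · subst hii
          have := hbv j (hlt j hj hij'.symm)
          simpa [Function.update_of_ne hij'.symm] using inner_eq_zero_symm.1 this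
        · by_cases hjj : j = i₀
          · subst hjj
            simpa [Function.update_of_ne hii] using hbv i (hlt i hi hii)
          · simpa [Function.update_of_ne hii, Function.update_of_ne hjj] using
              b.orthonormal.inner_eq_zero hij'
    obtain ⟨b', hb'⟩ := horth.exists_orthonormalBasis_extension_of_card_eq (by simpa using hm)
    refine ⟨b', fun i hi => ?_⟩
    rw [hb' i (Nat.lt_succ_iff.1 hi)]
    by_cases hii : i = i₀
    · subst hii
      refine ⟨x, ?_⟩
      rwa [Function.update_self, hvT, hwnorm]
    · rw [Function.update_of_ne hii]
      exact hb i (lt_of_le_of_ne (Nat.lt_succ_iff.1 hi) fun h => hii (Fin.ext h))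

/-- The Dvoretzky–Rogers lemma in terms of functionals. The functionals `u i` with `i ≥ m` are
irrelevant. -/
theorem exists_functionals_sum_sq_le
    {p : Seminorm 𝕜 X} {m : ℕ} (T₀ : X →L[𝕜] H)
    (hT₀ : Function.Surjective T₀) (hm : Module.finrank 𝕜 H = 2 * m)
    {C : ℝ} (hC : ∀ x, ‖T₀ x‖ ≤ C * p x) :
    ∃ u : ℕ → X →L[𝕜] 𝕜, (∀ x, ∑ i ∈ Finset.range m, ‖u i x‖ ^ 2 ≤ p x ^ 2) ∧
      ∀ i < m, ∃ x, p x ^ 2 < 2 * ‖u i x‖ ^ 2 := by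
  obtain ⟨T, hT, hdet⟩ := exists_dominated_norm_det_le_one p T₀ hT₀ hC
  obtain ⟨b, hb⟩ := exists_orthonormalBasis_lt_norm_inner hT hdet hm le_rfl
  refine ⟨fun i => if h : i < 2 * m then (innerSL 𝕜 (b ⟨i, h⟩)).comp T else 0, fun x => ?_,
    fun i hi => ?_⟩
  · refine le_trans (Finset.sum_le_sum_of_subset_of_nonneg (t := Finset.range (2 * m))
      (Finset.range_mono (by omega)) fun _ _ _ => by positivity) ?_
    rw [Finset.sum_range]
    refine le_of_eq_of_le ?_ (pow_le_pow_left₀ (norm_nonneg _) (hT x) 2)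
    rw [← b.sum_sq_norm_inner_right]
    exact Finset.sum_congr rfl fun i _ => by simp
  · have h : i < 2 * m := by omega
    simpa [h] using hb ⟨i, h⟩ hi

end DvoretzkyRogers

/-! ### Statistically null sequences in locally convex spaces -/

section LocallyConvex

variable {𝕜 : Type*} [RCLike 𝕜] {X : Type*} [AddCommGroup X] [Module 𝕜 X] [TopologicalSpace X]

theorem exists_surjective_continuousLinearMap [SeparatingDual 𝕜 X]
    (hX : ¬ FiniteDimensional 𝕜 X) (k : ℕ) :
    ∃ T : X →L[𝕜] EuclideanSpace 𝕜 (Fin k), Function.Surjective T := by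
  have hrank : (k : Cardinal) ≤ Module.rank 𝕜 X :=
    Cardinal.natCast_le_aleph0.trans (not_lt.1 fun h => hX (Module.rank_lt_aleph0_iff.1 h))
  obtain ⟨f, hf⟩ := Module.le_rank_iff_exists_linearMap.1 hrank
  choose g hg using fun i : Fin k =>
    (SeparatingDual.dualMap_surjective_iff (R := 𝕜)).2 hf (LinearMap.proj i)
  refine ⟨(EuclideanSpace.equiv (Fin k) 𝕜).symm.toContinuousLinearMap.comp
    (ContinuousLinearMap.pi g), fun y => ⟨f y, ?_⟩⟩
  ext i
  exact LinearMap.congr_fun (hg i) y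

theorem separatingDual_of_locallyConvexSpace_real [IsTopologicalAddGroup X]
    [ContinuousSMul 𝕜 X] [Module ℝ X] [IsScalarTower ℝ 𝕜 X] [LocallyConvexSpace ℝ X] [T1Space X] :
    SeparatingDual 𝕜 X :=
  ⟨fun _ hx => (RCLike.geometric_hahn_banach_point_point hx).imp fun f hf hf' => by
    simp [hf'] at hf⟩

open ComplexOrder in
theorem exists_seminorm_ball_subset [IsTopologicalAddGroup X] [ContinuousSMul 𝕜 X]
    [Module ℝ X] [IsScalarTower ℝ 𝕜 X] [LocallyConvexSpace ℝ X]
    {U : Set X} (hU : U ∈ 𝓝 (0 : X)) : ∃ p : Seminorm 𝕜 X, p.ball 0 1 ⊆ U := by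
  have : ContinuousSMul ℝ X := IsScalarTower.continuousSMul 𝕜
  have : LocallyConvexSpace 𝕜 X := LocallyConvexSpace.ofBasisZero 𝕜 X _ _
    (LocallyConvexSpace.convex_basis_zero ℝ X) fun s hs => convex_RCLike_iff_convex_real.2 hs.2
  obtain ⟨s, hs, hsU⟩ := (nhds_hasBasis_absConvex_open 𝕜 X).mem_iff.1 hU
  exact ⟨gaugeSeminormFamily 𝕜 X ⟨s, hs⟩, (gaugeSeminormFamily_ball _).trans_subset hsU⟩

/-- For every seminorm `p` there is a statistically null sequence of functionals none of which
is dominated by `p`. -/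
theorem exists_statistically_null_not_dominated
    [SeparatingDual 𝕜 X]
    (hX : ¬ FiniteDimensional 𝕜 X) (p : Seminorm 𝕜 X) :
    ∃ ψ : ℕ → X →L[𝕜] 𝕜, (∀ x, Tendsto (fun l => ψ l x) asymptoticDensityFilter (𝓝 0)) ∧
      ∀ l, ∃ x, p x < ‖ψ l x‖ := by
  by_cases hdom : ∀ f : X →L[𝕜] 𝕜, ∃ C : ℝ, ∀ x, ‖f x‖ ≤ C * p x
  · have hfam : ∀ J : ℕ, ∃ u : ℕ → X →L[𝕜] 𝕜,
        (∀ x, ∑ i ∈ Finset.range (2 ^ J), ‖u i x‖ ^ 2 ≤ p x ^ 2) ∧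
          ∀ i < 2 ^ J, ∃ x, p x ^ 2 < 2 * ‖u i x‖ ^ 2 := by
      intro J
      obtain ⟨T₀, hT₀⟩ := exists_surjective_continuousLinearMap hX (2 * 2 ^ J)
      choose C hC using fun i =>
        hdom ((EuclideanSpace.proj i : EuclideanSpace 𝕜 (Fin (2 * 2 ^ J)) →L[𝕜] 𝕜).comp T₀)
      refine exists_functionals_sum_sq_le T₀ hT₀ (by simp) (C := ∑ i, C i) fun x => ?_
      rw [Finset.sum_mul]
      have h1 : ‖T₀ x‖ ≤ ∑ i, ‖T₀ x i‖ := by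
        conv_lhs => rw [← (EuclideanSpace.basisFun (Fin (2 * 2 ^ J)) 𝕜).sum_repr (T₀ x)]
        refine (norm_sum_le _ _).trans (Finset.sum_le_sum fun i _ => ?_)
        simp [norm_smul]
      exact h1.trans (Finset.sum_le_sum fun i _ => hC i x)
    choose u hu hu' using hfam
    -- Any factor larger than `√2` turns the lower bound for `u` into failure of domination by `p`.
    refine ⟨fun l => (2 : 𝕜) • u (Nat.log 2 l) (l - 2 ^ Nat.log 2 l), fun x => ?_, fun l => ?_⟩
    · have h1 := tendsto_asymptoticDensityFilter_of_cesaro (fun l => by positivity)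
        (tendsto_cesaro_log_block (f := fun J i => ‖u J i x‖ ^ 2) (fun J i => by positivity)
          fun J => hu J x)
      have h2 := (h1.sqrt).const_mul 2
      simp only [Real.sqrt_sq (norm_nonneg _), Real.sqrt_zero, mul_zero] at h2
      refine tendsto_zero_iff_norm_tendsto_zero.2 (h2.congr fun l => ?_)
      simp
    · obtain ⟨x, hx⟩ := hu' (Nat.log 2 l) (l - 2 ^ Nat.log 2 l) (by
        have := Nat.lt_pow_succ_log_self one_lt_two l
        rw [pow_succ] at this
        have : 0 < 2 ^ Nat.log 2 l := by positivity
        omega)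
      refine ⟨x, lt_of_pow_lt_pow_left₀ 2 (norm_nonneg _) ?_⟩
      rw [smul_apply, norm_smul, mul_pow, RCLike.norm_ofNat]
      nlinarith [sq_nonneg ‖u (Nat.log 2 l) (l - 2 ^ Nat.log 2 l) x‖]
  · push Not at hdom
    obtain ⟨f, hf⟩ := hdom
    refine ⟨fun l => ((((l : ℝ) + 1)⁻¹ : ℝ) : 𝕜) • f, fun x => ?_, fun l => ?_⟩
    · have h1 : Tendsto (fun l : ℕ => (((l : ℝ) + 1)⁻¹ : ℝ) * ‖f x‖) atTop (𝓝 0) := by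
        simpa using (tendsto_one_div_add_atTop_nhds_zero_nat (𝕜 := ℝ)).mul_const ‖f x‖
      refine tendsto_zero_iff_norm_tendsto_zero.2
        ((h1.mono_left asymptoticDensityFilter_le_atTop).congr fun l => ?_)
      rw [smul_apply, norm_smul, RCLike.norm_ofReal, abs_of_pos (by positivity)]
    · obtain ⟨x, hx⟩ := hf (l + 1)
      refine ⟨x, ?_⟩
      rwa [smul_apply, norm_smul, RCLike.norm_ofReal, abs_of_pos (by positivity),
        lt_inv_mul_iff₀ (by positivity)]

end LocallyConvex

/-! ### Assembling the sequences along the 2-adic valuation -/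

theorem mainTheorem12 {𝕜 : Type*} [RCLike 𝕜] {X : Type*} [AddCommGroup X] [Module 𝕜 X]
    [Module ℝ X] [IsScalarTower ℝ 𝕜 X] [TopologicalSpace X] [IsTopologicalAddGroup X]
    [ContinuousSMul 𝕜 X] [LocallyConvexSpace ℝ X] [TopologicalSpace.MetrizableSpace X]
    (hX : ¬ FiniteDimensional 𝕜 X) :
    ∃ φ : ℕ → X →L[𝕜] 𝕜,
      (∀ x : X, Tendsto (fun l => φ l x) asymptoticDensityFilter (𝓝 0)) ∧
        ¬ FilterEquicontinuous asymptoticDensityFilter φ := by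
  have : SeparatingDual 𝕜 X := separatingDual_of_locallyConvexSpace_real
  obtain ⟨U, hU⟩ := (𝓝 (0 : X)).exists_antitone_basis
  choose p hp using fun n => exists_seminorm_ball_subset (𝕜 := 𝕜) (hU.1.mem_of_mem (i := n) trivial)
  choose ψ hψ hψp using fun n => exists_statistically_null_not_dominated hX (p n)
  refine ⟨fun l => ψ (padicValNat 2 l) l, fun x => ?_, fun hequi => ?_⟩
  · refine Metric.nhds_basis_ball.tendsto_right_iff.2 fun ε hε => ?_
    refine mem_asymptoticDensityFilter_of_union_dvd fun n => ?_
    -- Off the multiples of `2 ^ n`, only the sequences `ψ 0, …, ψ (n - 1)` occur.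
    have hall : ∀ᶠ l in asymptoticDensityFilter, ∀ i ∈ Finset.range n,
        ψ i l x ∈ Metric.ball (0 : 𝕜) ε :=
      (eventually_all_finset _).2 fun i _ => (hψ i x).eventually_mem (Metric.ball_mem_nhds 0 hε)
    filter_upwards [hall] with l hl
    by_cases hdvd : 2 ^ n ∣ l
    · exact Or.inr hdvd
    · refine Or.inl (hl _ (Finset.mem_range.2 ?_))
      have hl0 : l ≠ 0 := by rintro rfl; exact hdvd (dvd_zero _)
      exact not_le.1 fun h => hdvd ((padicValNat_dvd_iff_le hl0).2 h)
  · obtain ⟨W, hW, hWφ⟩ := hequi (Metric.ball 0 1) (Metric.ball_mem_nhds 0 one_pos)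
    obtain ⟨n, -, hn⟩ := hU.1.mem_iff.1 hW
    refine compl_dvd_notMem_asymptoticDensityFilter (r := 2 ^ n) (by positivity) ?_
    -- The index `l = 0` is discarded because `padicValNat 2 0 = 0`.
    filter_upwards [hWφ, asymptoticDensityFilter_le_atTop (eventually_ne_atTop 0)]
      with l hl hl0 hdvd
    have hle : n ≤ padicValNat 2 l := (padicValNat_dvd_iff_le hl0).1 hdvd
    obtain ⟨x, hx⟩ := hψp (padicValNat 2 l) l
    -- A multiple of `x` lies in the unit ball of the seminorm, while `ψ` is at least `1` there.
    have hψ0 : ψ (padicValNat 2 l) l x ≠ 0 := norm_pos_iff.1 ((apply_nonneg _ x).trans_lt hx)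
    have hmem : (ψ (padicValNat 2 l) l x)⁻¹ • x ∈ W := by
      refine hn (hU.2 hle (hp _ ?_))
      rw [Seminorm.mem_ball_zero, map_smul_eq_mul, norm_inv,
        inv_mul_lt_iff₀ (norm_pos_iff.2 hψ0), mul_one]
      exact hx
    have hone := hl (Set.mem_image_of_mem _ hmem)
    rw [map_smul, smul_eq_mul, inv_mul_cancel₀ hψ0] at hone
    simp at hone
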